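/- All graphs are finite and simple. Let $G=(V,E)$ be a graph with $n$ vertices, $m(G)$ edges and degree sequence $d_1\le d_2\le\dots\le d_n$, and let $j\ge 1$ be an integer. For $S\subseteq V$ let $m[S]$ be the number of edges of the subgraph $[S]$ induced by $S$. A set $I\subseteq V$ is $j$-independent if $[I]$ has maximum degree less than $j$; $\alpha_j(G)$ is the largest cardinality of a $j$-independent set, and $F$ is the family of all $j$-independent sets of cardinality $\alpha_j(G)$. Put $$a_j(G)=\max\Big\{0\le k\le n:\ \sum_{i=1}^k d_i+\max_{S\in F}\{m[V-S]-m[S]\}\le m(G)\Big\},$$ $$c_j(G)=\min\Big\{0\le k\le n:\ \sum_{i=1}^k d_{n-i+1}+\min_{S\in F}\{m[V-S]-m[S]\}\ge m(G)\Big\}.$$ Let $K_r$ and $E_r$ be the complete and the empty graph on $r$ vertices, let $bH$ denote the disjoint union of $b$ copies of $H$, and let $G+H$ denote the join of $G$ and $H$. For $p,q,r,j$ let $G(p,q,r,j)$ be the graph obtained from the disjoint union of $K_q$ and $q$ copies of $pK_r+(p+1)K_j$ by assigning to each copy its own vertex of $K_q$ and joining that vertex to all vertices of the copy. **Theorem.**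 For every fixed integer $j\ge 1$: 1. the graph $G=jK_j+jK_j$ satisfies $c_j(G)=\alpha_j(G)=a_j(G)$; 2. the graphs $G_p=pK_{p^2}+(p+1)K_j$ satisfy $c_j(G_p)=\alpha_j(G_p)$ for every $p$ with $p+j\le p^2$ (hence for all large $p$), and $\dfrac{a_j(G_p)}{\alpha_j(G_p)}\to\infty$ as $p\to\infty$; 3. the graphs $G_p=E_{p^2}+K_p$ satisfy $a_j(G_p)=\alpha_j(G_p)$ for every $p$ with $j<p^2$, and $\dfrac{\alpha_j(G_p)}{c_j(G_p)}\to\infty$ as $p\to\infty$; 4. the graphs $G_p=G(p,p^2,p^2,j)$ satisfy both $\alpha_j(G_p)-c_j(G_p)\to\infty$ and $\dfrac{a_j(G_p)}{\alpha_j(G_p)}\to\infty$ as $p\to\infty$. -/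

import Mathlib

open Filter

open scoped Classical

/-! ### Independence and annihilation numbers -/

/-- The size of the subgraph `[S]` induced by `S`. -/
noncomputable def inducedSize {V : Type} (G : SimpleGraph V) (S : Finset V) : ℕ :=
  (G.induce (S : Set V)).edgeSet.ncard

/-- `I` is `j`-independent: the maximum degree of the induced subgraph `[I]` is less than `j`. -/
def IsJIndependent {V : Type} (G : SimpleGraph V) (j : ℕ) (I : Finset V) : Prop :=
  (G.induce (I : Set V)).maxDegree < j

/-- The `j`-independence number: the largest cardinality of a `j`-independent set. -/
noncomputable def jIndepNum {V : Type} [Fintype V] (G : SimpleGraph V) (j : ℕ) : ℕ :=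
  (Finset.univ.filter fun I : Finset V => IsJIndependent G j I).sup Finset.card

/-- The family `F` of all maximum `j`-independent sets. -/
noncomputable def maxJIndepSets {V : Type} [Fintype V] (G : SimpleGraph V) (j : ℕ) :
    Finset (Finset V) :=
  Finset.univ.filter fun I => IsJIndependent G j I ∧ I.card = jIndepNum G j

/-- The set of all values `m[V - S] - m[S]`, where `S` ranges over the maximum `j`-independent
sets. -/
noncomputable def sizeDifferences {V : Type} [Fintype V] (G : SimpleGraph V) (j : ℕ) :
    Finset ℤ :=
  (maxJIndepSets G j).image fun S => (inducedSize G Sᶜ : ℤ) - (inducedSize G S : ℤ)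

/-- The maximum of `m[V - S] - m[S]` over the maximum `j`-independent sets `S`. -/
noncomputable def maxSizeDifference {V : Type} [Fintype V] (G : SimpleGraph V) (j : ℕ) : ℤ :=
  sSup (sizeDifferences G j : Set ℤ)

/-- The minimum of `m[V - S] - m[S]` over the maximum `j`-independent sets `S`. -/
noncomputable def minSizeDifference {V : Type} [Fintype V] (G : SimpleGraph V) (j : ℕ) : ℤ :=
  sInf (sizeDifferences G j : Set ℤ)

/-- The degree sequence `d₁ ≤ d₂ ≤ ⋯ ≤ dₙ`. -/
noncomputable def degreeSeq {V : Type} [Fintype V] (G : SimpleGraph V) : List ℕ :=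
  (Finset.univ.val.map fun v => G.degree v).sort

/-- The sum `d₁ + ⋯ + dₖ` of the `k` smallest degrees. -/
noncomputable def sumSmallestDegrees {V : Type} [Fintype V] (G : SimpleGraph V) (k : ℕ) : ℕ :=
  ((degreeSeq G).take k).sum

/-- The sum `dₙ + dₙ₋₁ + ⋯ + dₙ₋ₖ₊₁` of the `k` largest degrees. -/
noncomputable def sumLargestDegrees {V : Type} [Fintype V] (G : SimpleGraph V) (k : ℕ) : ℕ :=
  ((degreeSeq G).reverse.take k).sum

/-- The indices `0 ≤ k ≤ n` admitted in the definition of the upper `j`-annihilation number. -/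
def upperAnnihilationSet {V : Type} [Fintype V] (G : SimpleGraph V) (j : ℕ) : Set ℕ :=
  {k | k ≤ Fintype.card V ∧
    (sumSmallestDegrees G k : ℤ) + maxSizeDifference G j ≤ (G.edgeFinset.card : ℤ)}

/-- The indices `0 ≤ k ≤ n` admitted in the definition of the lower `j`-annihilation number. -/
def lowerAnnihilationSet {V : Type} [Fintype V] (G : SimpleGraph V) (j : ℕ) : Set ℕ :=
  {k | k ≤ Fintype.card V ∧
    (sumLargestDegrees G k : ℤ) + minSizeDifference G j ≥ (G.edgeFinset.card : ℤ)}

/-- The upper `j`-annihilation number `a_j(G)`. -/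
noncomputable def upperAnnihilationNum {V : Type} [Fintype V] (G : SimpleGraph V) (j : ℕ) : ℕ :=
  sSup (upperAnnihilationSet G j)

/-- The lower `j`-annihilation number `c_j(G)`. -/
noncomputable def lowerAnnihilationNum {V : Type} [Fintype V] (G : SimpleGraph V) (j : ℕ) : ℕ :=
  sInf (lowerAnnihilationSet G j)

/-! ### The extrema above are attained when `j` is positive -/

theorem maxJIndepSets_nonempty {V : Type} [Fintype V] (G : SimpleGraph V) {j : ℕ} (hj : 1 ≤ j) :
    (maxJIndepSets G j).Nonempty := by
  have hne : (Finset.univ.filter fun I : Finset V => IsJIndependent G j I).Nonempty := by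
    refine ⟨∅, ?_⟩
    simp only [Finset.mem_filter, Finset.mem_univ, true_and]
    have hE : IsEmpty ((∅ : Finset V) : Set V) := by simp
    unfold IsJIndependent
    have h0 : (G.induce ((∅ : Finset V) : Set V)).maxDegree ≤ 0 :=
      SimpleGraph.maxDegree_le_of_forall_degree_le _ _ fun v => hE.elim v
    omega
  obtain ⟨I, hI, hc⟩ := Finset.exists_mem_eq_sup _ hne Finset.card
  simp only [Finset.mem_filter, Finset.mem_univ, true_and] at hI
  refine ⟨I, ?_⟩
  simp only [maxJIndepSets, Finset.mem_filter, Finset.mem_univ, true_and]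
  exact ⟨hI, hc.symm⟩

theorem sizeDifferences_nonempty {V : Type} [Fintype V] (G : SimpleGraph V) {j : ℕ}
    (hj : 1 ≤ j) : (sizeDifferences G j).Nonempty :=
  (maxJIndepSets_nonempty G hj).image _

theorem isGreatest_maxSizeDifference {V : Type} [Fintype V] (G : SimpleGraph V) {j : ℕ}
    (hj : 1 ≤ j) : IsGreatest (sizeDifferences G j : Set ℤ) (maxSizeDifference G j) :=
  ⟨Finset.Nonempty.csSup_mem (sizeDifferences_nonempty G hj),
    fun _ hx => le_csSup (Finset.bddAbove _) hx⟩

theorem isLeast_minSizeDifference {V : Type} [Fintype V] (G : SimpleGraph V) {j : ℕ}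
    (hj : 1 ≤ j) : IsLeast (sizeDifferences G j : Set ℤ) (minSizeDifference G j) :=
  ⟨Finset.Nonempty.csInf_mem (sizeDifferences_nonempty G hj),
    fun _ hx => csInf_le (Finset.bddBelow _) hx⟩

theorem inducedSize_le {V : Type} [Fintype V] (G : SimpleGraph V) (S : Finset V) :
    inducedSize G S ≤ G.edgeFinset.card := by
  unfold inducedSize
  rw [← Set.ncard_coe_finset, SimpleGraph.coe_edgeFinset]
  refine Set.ncard_le_ncard_of_injOn (Sym2.map Subtype.val) ?_
    (Sym2.map.injective Subtype.val_injective).injOn (Set.toFinite _)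
  intro e
  induction e with | _ a b => exact fun h => h

theorem isGreatest_upperAnnihilationNum {V : Type} [Fintype V] (G : SimpleGraph V) {j : ℕ}
    (hj : 1 ≤ j) : IsGreatest (upperAnnihilationSet G j) (upperAnnihilationNum G j) := by
  have hb : BddAbove (upperAnnihilationSet G j) := ⟨Fintype.card V, fun k hk => hk.1⟩
  refine ⟨Nat.sSup_mem ⟨0, Nat.zero_le _, ?_⟩ hb, fun k hk => le_csSup hb hk⟩
  have h := (isGreatest_maxSizeDifference G hj).1
  simp only [sizeDifferences, Finset.coe_image, Set.mem_image] at h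
  obtain ⟨S, -, hS⟩ := h
  have := inducedSize_le G Sᶜ
  simp only [sumSmallestDegrees, List.take_zero, List.sum_nil]
  omega

theorem isLeast_lowerAnnihilationNum {V : Type} [Fintype V] (G : SimpleGraph V) {j : ℕ}
    (hj : 1 ≤ j) : IsLeast (lowerAnnihilationSet G j) (lowerAnnihilationNum G j) := by
  refine ⟨Nat.sInf_mem ⟨Fintype.card V, le_rfl, ?_⟩, fun k hk => Nat.sInf_le hk⟩
  have h := (isLeast_minSizeDifference G hj).1
  simp only [sizeDifferences, Finset.coe_image, Set.mem_image] at h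
  obtain ⟨S, -, hS⟩ := h
  have h1 := inducedSize_le G S
  have h2 : sumLargestDegrees G (Fintype.card V) = 2 * G.edgeFinset.card := by
    rw [← G.sum_degrees_eq_twice_card_edges, sumLargestDegrees, List.take_of_length_le]
    · rw [List.sum_reverse, ← Multiset.sum_coe, degreeSeq, Multiset.sort_eq]
      rfl
    · simp [degreeSeq]
  rw [h2]
  push_cast
  omega

/-! ### Graph constructions -/

/-- The join `G + H`: the disjoint union of `G` and `H` together with all edges between them. -/
def graphJoin {V W : Type} (G : SimpleGraph V) (H : SimpleGraph W) : SimpleGraph (V ⊕ W) where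
  Adj
    | Sum.inl u, Sum.inl v => G.Adj u v
    | Sum.inr u, Sum.inr v => H.Adj u v
    | Sum.inl _, Sum.inr _ => True
    | Sum.inr _, Sum.inl _ => True
  symm.symm := by
    rintro (u | u) (v | v) h
    · exact G.adj_symm h
    · trivial
    · trivial
    · exact H.adj_symm h
  loopless.irrefl := by
    rintro (u | u) h
    · exact G.irrefl h
    · exact H.irrefl h

/-- The disjoint union of `b` copies of the complete graph `K_r`. -/
def cliqueUnion (b r : ℕ) : SimpleGraph (Fin b × Fin r) where
  Adj u v := u.1 = v.1 ∧ u.2 ≠ v.2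
  symm.symm := fun _ _ h => ⟨h.1.symm, h.2.symm⟩
  loopless.irrefl := fun _ h => h.2 rfl

/-- The complete graph `K_q` and `q` disjoint copies of `H`, with the `i`-th vertex of `K_q` joined
to all vertices of the `i`-th copy of `H`. -/
def cliqueWithCopies {W : Type} (q : ℕ) (H : SimpleGraph W) :
    SimpleGraph (Fin q ⊕ (Fin q × W)) where
  Adj
    | Sum.inl s, Sum.inl t => s ≠ t
    | Sum.inr u, Sum.inr v => u.1 = v.1 ∧ H.Adj u.2 v.2
    | Sum.inl s, Sum.inr v => s = v.1
    | Sum.inr u, Sum.inl t => u.1 = t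
  symm.symm := by
    rintro (u | u) (v | v) h
    · exact Ne.symm h
    · exact Eq.symm h
    · exact Eq.symm h
    · exact ⟨h.1.symm, H.adj_symm h.2⟩
  loopless.irrefl := by
    rintro (u | u) h
    · exact h rfl
    · exact H.irrefl h.2

/-- The graph `(⋃_{i=1}^{j} K_j) + (⋃_{i=1}^{j} K_j)`. -/
def sharpGraph (j : ℕ) : SimpleGraph ((Fin j × Fin j) ⊕ (Fin j × Fin j)) :=
  graphJoin (cliqueUnion j j) (cliqueUnion j j)

/-- The graph `(⋃_{i=1}^{p} K_r) + (⋃_{i=1}^{p+1} K_j)`. -/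
def cliqueUnionJoin (p r j : ℕ) : SimpleGraph ((Fin p × Fin r) ⊕ (Fin (p + 1) × Fin j)) :=
  graphJoin (cliqueUnion p r) (cliqueUnion (p + 1) j)

/-- The complete split graph `E_s + K_p`, the join of an empty graph and a complete graph. -/
def completeSplitGraph (s p : ℕ) : SimpleGraph (Fin s ⊕ Fin p) :=
  graphJoin ⊥ ⊤

/-- The graph `G(p, q, r, j)`: the complete graph `K_q` with `q` copies of
`(⋃_{i=1}^{p} K_r) + (⋃_{i=1}^{p+1} K_j)`, each joined to its own vertex of `K_q`. -/
def compositeGraph (p q r j : ℕ) :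
    SimpleGraph (Fin q ⊕ (Fin q × ((Fin p × Fin r) ⊕ (Fin (p + 1) × Fin j)))) :=
  cliqueWithCopies q (cliqueUnionJoin p r j)

/-! ### Degree sums over vertex sets -/

/-! Counting edge ends gives `∑ v ∈ S, deg v = m(G) + m[S] - m[V - S]`
(`sum_degree_add_inducedSize_compl`), so `m(G)` cancels from both definitions. The upper number is
the largest `k` for which the `k` smallest degrees sum to at most the least degree sum of a maximum
`j`-independent set; the lower number is the smallest `k` for which the `k` largest degrees reach
the greatest such sum. Hence `c_j ≤ α_j ≤ a_j`. Moreover, comparing degree sums with any vertex set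
`T` bounds either number by `T.card`, and a uniform degree bound gives the opposite estimate
(`exists_upperAnnihilationNum_bounds`, `exists_lowerAnnihilationNum_bounds`).

A regular graph therefore has all three numbers equal. Each other family has a unique maximum
`j`-independent set `S` (`IsUniqueMaxJIndep`), all of whose vertices have one common degree, and
only degree sums need comparing. If that degree is the maximum degree then `c_j = α_j`; if it is the
minimum then `a_j = α_j`. The gaps come from replacing `S`: by many vertices of the large cliques,
of degree about `p ^ 2` against `p ^ 3` in `S`; by the few vertices of `K_p` in the split graph; or,
in the composite graph, by trading `p ^ 2 + p - 1` vertices of `S` for the `p ^ 2` vertices of the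
central clique. -/

theorem degree_eq_sum_ite {V : Type} [Fintype V] (G : SimpleGraph V) (v : V)
    [Fintype (G.neighborSet v)] : G.degree v = ∑ w, if G.Adj v w then 1 else 0 := by
  rw [← SimpleGraph.card_neighborFinset_eq_degree, ← Finset.card_filter]
  congr 1
  ext w
  simp

theorem induce_degree_eq {V : Type} [Fintype V] (G : SimpleGraph V) (S : Finset V)
    (v : (S : Set V)) : (G.induce (S : Set V)).degree v = (S.filter fun w => G.Adj v w).card := by
  rw [degree_eq_sum_ite, Finset.card_filter]
  exact Finset.sum_coe_sort S (fun w => if G.Adj v w then 1 else 0)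

theorem two_mul_inducedSize {V : Type} [Fintype V] (G : SimpleGraph V) (S : Finset V) :
    2 * inducedSize G S = ∑ v ∈ S, ∑ w ∈ S, if G.Adj v w then 1 else 0 := by
  have h := (G.induce (S : Set V)).sum_degrees_eq_twice_card_edges
  rw [inducedSize, ← SimpleGraph.coe_edgeFinset, Set.ncard_coe_finset, ← h]
  simp only [induce_degree_eq, Finset.card_filter]
  exact Finset.sum_coe_sort S (fun v => ∑ w ∈ S, if G.Adj v w then 1 else 0)

/-- Edges inside `S` count twice in the degree sum, edges leaving `S` once, and the remaining edges
lie inside the complement. -/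
theorem sum_degree_add_inducedSize_compl {V : Type} [Fintype V] (G : SimpleGraph V)
    (S : Finset V) :
    ∑ v ∈ S, G.degree v + inducedSize G Sᶜ = G.edgeFinset.card + inducedSize G S := by
  have h1 := two_mul_inducedSize G S
  have h2 := two_mul_inducedSize G Sᶜ
  have h3 := G.sum_degrees_eq_twice_card_edges
  have hsplit : ∀ A : Finset V, ∑ v ∈ A, G.degree v =
      (∑ v ∈ A, ∑ w ∈ S, if G.Adj v w then 1 else 0) +
        ∑ v ∈ A, ∑ w ∈ Sᶜ, if G.Adj v w then 1 else 0 := by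
    intro A
    rw [← Finset.sum_add_distrib]
    refine Finset.sum_congr rfl fun v _ => ?_
    rw [degree_eq_sum_ite, Finset.sum_add_sum_compl]
  have h4 := hsplit S
  have h5 := hsplit Sᶜ
  have h6 : (∑ v ∈ Sᶜ, ∑ w ∈ S, if G.Adj v w then 1 else 0) =
      ∑ v ∈ S, ∑ w ∈ Sᶜ, if G.Adj v w then 1 else 0 := by
    rw [Finset.sum_comm]
    simp only [G.adj_comm]
  have h7 := Finset.sum_add_sum_compl S (fun v => G.degree v)
  omega

theorem mem_sizeDifferences {V : Type} [Fintype V] {G : SimpleGraph V} {j : ℕ} {x : ℤ}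
    (hx : x ∈ sizeDifferences G j) :
    ∃ S ∈ maxJIndepSets G j, x = (G.edgeFinset.card : ℤ) - (∑ v ∈ S, G.degree v : ℕ) := by
  simp only [sizeDifferences, Finset.mem_image] at hx
  obtain ⟨S, hS, rfl⟩ := hx
  refine ⟨S, hS, ?_⟩
  have := sum_degree_add_inducedSize_compl G S
  omega

/-! ### Extremal partial sums of the degree sequence -/

/-- Deleting the head of a sorted list shifts every entry of a prefix to a larger or equal one. -/
theorem sum_take_cons_le {l : List ℕ} : ∀ {a k : ℕ}, (a :: l).Pairwise (· ≤ ·) → k ≤ l.length →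
    ((a :: l).take k).sum ≤ (l.take k).sum := by
  induction l with
  | nil => intro a k _ hk; simp_all
  | cons b l ih =>
    intro a k h hk
    cases k with
    | zero => simp
    | succ k =>
      have h1 := ih (k := k) (List.pairwise_cons.1 h).2 (by simpa using hk)
      have h2 := (List.pairwise_cons.1 h).1 b (by simp)
      simp only [List.take_succ_cons, List.sum_cons] at h1 ⊢
      omega

theorem List.Sublist.sum_take_le {s l : List ℕ} (h : s.Sublist l) (hl : l.Pairwise (· ≤ ·)) :
    (l.take s.length).sum ≤ s.sum := by
  induction h with
  | slnil => simp
  | cons a h ih => exact (sum_take_cons_le hl h.length_le).trans (ih (List.pairwise_cons.1 hl).2)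
  | cons_cons a h ih => simpa using ih (List.pairwise_cons.1 hl).2

theorem coe_degreeSeq {V : Type} [Fintype V] (G : SimpleGraph V) :
    (degreeSeq G : Multiset ℕ) = Finset.univ.val.map fun v => G.degree v :=
  Multiset.sort_eq _ _

theorem length_degreeSeq {V : Type} [Fintype V] (G : SimpleGraph V) :
    (degreeSeq G).length = Fintype.card V := by
  simp [degreeSeq]

theorem mem_degreeSeq {V : Type} [Fintype V] {G : SimpleGraph V} {d : ℕ} :
    d ∈ degreeSeq G ↔ ∃ v, G.degree v = d := by
  simp [degreeSeq]

theorem sumSmallestDegrees_card_le {V : Type} [Fintype V] (G : SimpleGraph V) (T : Finset V) :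
    sumSmallestDegrees G T.card ≤ ∑ v ∈ T, G.degree v := by
  have hle : T.val.map (fun v => G.degree v) ≤ Finset.univ.val.map fun v => G.degree v :=
    Multiset.map_le_map (Finset.val_le_iff.2 (Finset.subset_univ T))
  have hsub : ((T.val.map fun v => G.degree v).sort).Sublist (degreeSeq G) := by
    refine List.sublist_of_subperm_of_pairwise ?_ (Multiset.pairwise_sort _ _)
      (Multiset.pairwise_sort _ _)
    rw [← Multiset.coe_le, Multiset.sort_eq, coe_degreeSeq]
    exact hle
  have h := hsub.sum_take_le (Multiset.pairwise_sort _ _)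
  rw [← Multiset.sum_coe (Multiset.sort _ _), Multiset.sort_eq, Multiset.length_sort,
    Multiset.card_map] at h
  exact h

theorem sumLargestDegrees_add {V : Type} [Fintype V] (G : SimpleGraph V) (k : ℕ) :
    sumLargestDegrees G k + sumSmallestDegrees G (Fintype.card V - k) = ∑ v, G.degree v := by
  have h : (degreeSeq G).sum = ∑ v, G.degree v := by
    rw [← Multiset.sum_coe, coe_degreeSeq]
    rfl
  rw [sumLargestDegrees, sumSmallestDegrees, List.take_reverse, List.sum_reverse,
    length_degreeSeq, add_comm, List.sum_take_add_sum_drop, h]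

/-- Dual to the bound for the smallest degrees: apply that bound to the complement and subtract from
the total degree. -/
theorem le_sumLargestDegrees_card {V : Type} [Fintype V] (G : SimpleGraph V) (T : Finset V) :
    ∑ v ∈ T, G.degree v ≤ sumLargestDegrees G T.card := by
  have h1 := sumSmallestDegrees_card_le G Tᶜ
  have h2 := sumLargestDegrees_add G T.card
  have h3 := Finset.sum_add_sum_compl T (fun v => G.degree v)
  rw [Finset.card_compl] at h1
  omega

theorem mul_le_sumSmallestDegrees {V : Type} [Fintype V] {G : SimpleGraph V} {d k : ℕ}
    (hd : ∀ v, d ≤ G.degree v) (hk : k ≤ Fintype.card V) : k * d ≤ sumSmallestDegrees G k := by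
  have h := List.card_nsmul_le_sum ((degreeSeq G).take k) d fun x hx => by
    obtain ⟨v, rfl⟩ := mem_degreeSeq.1 (List.mem_of_mem_take hx)
    exact hd v
  simpa [length_degreeSeq, hk, sumSmallestDegrees] using h

theorem sumLargestDegrees_le_mul {V : Type} [Fintype V] {G : SimpleGraph V} {d k : ℕ}
    (hd : ∀ v, G.degree v ≤ d) (hk : k ≤ Fintype.card V) : sumLargestDegrees G k ≤ k * d := by
  have h := List.sum_le_card_nsmul ((degreeSeq G).reverse.take k) d fun x hx => by
    obtain ⟨v, rfl⟩ := mem_degreeSeq.1 (List.mem_reverse.1 (List.mem_of_mem_take hx))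
    exact hd v
  simpa [length_degreeSeq, hk, sumLargestDegrees] using h

/-! ### Bounds for the annihilation numbers -/

/-- `S` attains the maximum difference, hence has the least degree sum among the maximum
`j`-independent sets. The two clauses bound the annihilation number from below and from above. -/
theorem exists_upperAnnihilationNum_bounds {V : Type} [Fintype V] (G : SimpleGraph V) {j : ℕ}
    (hj : 1 ≤ j) : ∃ S ∈ maxJIndepSets G j,
      (∀ T : Finset V, ∑ v ∈ T, G.degree v ≤ ∑ v ∈ S, G.degree v →
        T.card ≤ upperAnnihilationNum G j) ∧
      ∀ d, (∀ v, d ≤ G.degree v) → upperAnnihilationNum G j * d ≤ ∑ v ∈ S, G.degree v := by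
  obtain ⟨S, hS, hx⟩ := mem_sizeDifferences (isGreatest_maxSizeDifference G hj).1
  obtain ⟨⟨h1, h2⟩, h3⟩ := isGreatest_upperAnnihilationNum G hj
  refine ⟨S, hS, fun T hT => h3 ⟨Finset.card_le_univ T, ?_⟩, fun d hd => ?_⟩
  · have := sumSmallestDegrees_card_le G T
    omega
  · have := mul_le_sumSmallestDegrees hd h1
    omega

theorem exists_lowerAnnihilationNum_bounds {V : Type} [Fintype V] (G : SimpleGraph V) {j : ℕ}
    (hj : 1 ≤ j) : ∃ S ∈ maxJIndepSets G j,
      (∀ T : Finset V, ∑ v ∈ S, G.degree v ≤ ∑ v ∈ T, G.degree v →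
        lowerAnnihilationNum G j ≤ T.card) ∧
      ∀ d, (∀ v, G.degree v ≤ d) → ∑ v ∈ S, G.degree v ≤ lowerAnnihilationNum G j * d := by
  obtain ⟨S, hS, hx⟩ := mem_sizeDifferences (isLeast_minSizeDifference G hj).1
  obtain ⟨⟨h1, h2⟩, h3⟩ := isLeast_lowerAnnihilationNum G hj
  refine ⟨S, hS, fun T hT => h3 ⟨Finset.card_le_univ T, ?_⟩, fun d hd => ?_⟩
  · have := le_sumLargestDegrees_card G T
    omega
  · have := sumLargestDegrees_le_mul hd h1
    omega

theorem card_of_mem_maxJIndepSets {V : Type} [Fintype V] {G : SimpleGraph V} {j : ℕ}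
    {S : Finset V} (hS : S ∈ maxJIndepSets G j) : S.card = jIndepNum G j := by
  simp only [maxJIndepSets, Finset.mem_filter] at hS
  exact hS.2.2

theorem jIndepNum_le_upperAnnihilationNum {V : Type} [Fintype V] (G : SimpleGraph V) {j : ℕ}
    (hj : 1 ≤ j) : jIndepNum G j ≤ upperAnnihilationNum G j := by
  obtain ⟨S, hS, h, -⟩ := exists_upperAnnihilationNum_bounds G hj
  exact card_of_mem_maxJIndepSets hS ▸ h S le_rfl

theorem lowerAnnihilationNum_le_jIndepNum {V : Type} [Fintype V] (G : SimpleGraph V) {j : ℕ}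
    (hj : 1 ≤ j) : lowerAnnihilationNum G j ≤ jIndepNum G j := by
  obtain ⟨S, hS, h, -⟩ := exists_lowerAnnihilationNum_bounds G hj
  exact card_of_mem_maxJIndepSets hS ▸ h S le_rfl

theorem upperAnnihilationNum_eq_of_regular {V : Type} [Fintype V] {G : SimpleGraph V} {j d : ℕ}
    (hj : 1 ≤ j) (hd : 0 < d) (h : ∀ v, G.degree v = d) :
    upperAnnihilationNum G j = jIndepNum G j := by
  refine le_antisymm ?_ (jIndepNum_le_upperAnnihilationNum G hj)
  obtain ⟨S, hS, -, h2⟩ := exists_upperAnnihilationNum_bounds G hj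
  have := h2 d fun v => (h v).ge
  simp only [h, Finset.sum_const, smul_eq_mul, card_of_mem_maxJIndepSets hS] at this
  exact Nat.le_of_mul_le_mul_right this hd

theorem lowerAnnihilationNum_eq_of_regular {V : Type} [Fintype V] {G : SimpleGraph V} {j d : ℕ}
    (hj : 1 ≤ j) (hd : 0 < d) (h : ∀ v, G.degree v = d) :
    lowerAnnihilationNum G j = jIndepNum G j := by
  refine le_antisymm (lowerAnnihilationNum_le_jIndepNum G hj) ?_
  obtain ⟨S, hS, -, h2⟩ := exists_lowerAnnihilationNum_bounds G hj
  have := h2 d fun v => (h v).le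
  simp only [h, Finset.sum_const, smul_eq_mul, card_of_mem_maxJIndepSets hS] at this
  exact Nat.le_of_mul_le_mul_right this hd

/-! ### `j`-independent sets -/

theorem isJIndependent_iff {V : Type} [Fintype V] {G : SimpleGraph V} {j : ℕ} (hj : 1 ≤ j)
    {I : Finset V} :
    IsJIndependent G j I ↔ ∀ v ∈ I, (I.filter fun w => G.Adj v w).card < j := by
  constructor
  · intro h v hv
    have := (G.induce (I : Set V)).degree_le_maxDegree ⟨v, hv⟩
    rw [induce_degree_eq] at this
    exact this.trans_lt h
  · intro h
    -- The bound `j - 1` also covers the empty set, whose maximum degree is `0` by convention; this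
    -- is where `1 ≤ j` matters.
    have : (G.induce (I : Set V)).maxDegree ≤ j - 1 :=
      SimpleGraph.maxDegree_le_of_forall_degree_le _ _ fun v => by
        rw [induce_degree_eq]
        have := h v v.2
        omega
    unfold IsJIndependent
    omega

/-- `S` is the only `j`-independent set of maximum cardinality. -/
def IsUniqueMaxJIndep {V : Type} (G : SimpleGraph V) (j : ℕ) (S : Finset V) : Prop :=
  IsJIndependent G j S ∧ ∀ I, IsJIndependent G j I → I ≠ S → I.card < S.card

namespace IsUniqueMaxJIndep

variable {V : Type} [Fintype V] {G : SimpleGraph V} {j : ℕ} {S : Finset V}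

theorem jIndepNum_eq (h : IsUniqueMaxJIndep G j S) : jIndepNum G j = S.card := by
  refine le_antisymm (Finset.sup_le fun I hI => ?_) ?_
  · by_cases hIS : I = S
    · rw [hIS]
    · exact (h.2 I (by simpa using hI) hIS).le
  · exact Finset.le_sup (f := Finset.card) (by simpa using h.1)

theorem eq_of_mem (h : IsUniqueMaxJIndep G j S) {I : Finset V} (hI : I ∈ maxJIndepSets G j) :
    I = S := by
  simp only [maxJIndepSets, Finset.mem_filter, h.jIndepNum_eq] at hI
  by_contra hne
  exact (h.2 I hI.2.1 hne).ne hI.2.2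

theorem card_le_upperAnnihilationNum (h : IsUniqueMaxJIndep G j S) (hj : 1 ≤ j) {T : Finset V}
    (hT : ∑ v ∈ T, G.degree v ≤ ∑ v ∈ S, G.degree v) : T.card ≤ upperAnnihilationNum G j := by
  obtain ⟨I, hI, h1, -⟩ := exists_upperAnnihilationNum_bounds G hj
  rw [h.eq_of_mem hI] at h1
  exact h1 T hT

theorem upperAnnihilationNum_mul_le (h : IsUniqueMaxJIndep G j S) (hj : 1 ≤ j) {d : ℕ}
    (hd : ∀ v, d ≤ G.degree v) : upperAnnihilationNum G j * d ≤ ∑ v ∈ S, G.degree v := by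
  obtain ⟨I, hI, -, h1⟩ := exists_upperAnnihilationNum_bounds G hj
  rw [h.eq_of_mem hI] at h1
  exact h1 d hd

theorem lowerAnnihilationNum_le_card (h : IsUniqueMaxJIndep G j S) (hj : 1 ≤ j) {T : Finset V}
    (hT : ∑ v ∈ S, G.degree v ≤ ∑ v ∈ T, G.degree v) : lowerAnnihilationNum G j ≤ T.card := by
  obtain ⟨I, hI, h1, -⟩ := exists_lowerAnnihilationNum_bounds G hj
  rw [h.eq_of_mem hI] at h1
  exact h1 T hT

theorem le_lowerAnnihilationNum_mul (h : IsUniqueMaxJIndep G j S) (hj : 1 ≤ j) {d : ℕ}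
    (hd : ∀ v, G.degree v ≤ d) : ∑ v ∈ S, G.degree v ≤ lowerAnnihilationNum G j * d := by
  obtain ⟨I, hI, -, h1⟩ := exists_lowerAnnihilationNum_bounds G hj
  rw [h.eq_of_mem hI] at h1
  exact h1 d hd

end IsUniqueMaxJIndep

/-! ### Adjacency and degrees in the constructions -/

section Constructions

variable {V W : Type} (G : SimpleGraph V) (H : SimpleGraph W) {b q r : ℕ}

@[simp] theorem graphJoin_adj_inl_inl {u v : V} :
    (graphJoin G H).Adj (Sum.inl u) (Sum.inl v) ↔ G.Adj u v := Iff.rfl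

@[simp] theorem graphJoin_adj_inr_inr {u v : W} :
    (graphJoin G H).Adj (Sum.inr u) (Sum.inr v) ↔ H.Adj u v := Iff.rfl

@[simp] theorem graphJoin_adj_inl_inr {u : V} {v : W} :
    (graphJoin G H).Adj (Sum.inl u) (Sum.inr v) := trivial

@[simp] theorem graphJoin_adj_inr_inl {u : W} {v : V} :
    (graphJoin G H).Adj (Sum.inr u) (Sum.inl v) := trivial

@[simp] theorem cliqueUnion_adj {u v : Fin b × Fin r} :
    (cliqueUnion b r).Adj u v ↔ u.1 = v.1 ∧ u.2 ≠ v.2 := Iff.rfl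

@[simp] theorem cliqueWithCopies_adj_inl_inl {s t : Fin q} :
    (cliqueWithCopies q H).Adj (Sum.inl s) (Sum.inl t) ↔ s ≠ t := Iff.rfl

@[simp] theorem cliqueWithCopies_adj_inr_inr {u v : Fin q × W} :
    (cliqueWithCopies q H).Adj (Sum.inr u) (Sum.inr v) ↔ u.1 = v.1 ∧ H.Adj u.2 v.2 := Iff.rfl

@[simp] theorem cliqueWithCopies_adj_inl_inr {s : Fin q} {v : Fin q × W} :
    (cliqueWithCopies q H).Adj (Sum.inl s) (Sum.inr v) ↔ s = v.1 := Iff.rfl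

@[simp] theorem cliqueWithCopies_adj_inr_inl {s : Fin q} {v : Fin q × W} :
    (cliqueWithCopies q H).Adj (Sum.inr v) (Sum.inl s) ↔ v.1 = s := Iff.rfl

theorem degree_graphJoin_inl [Fintype V] [Fintype W] (v : V) :
    (graphJoin G H).degree (Sum.inl v) = G.degree v + Fintype.card W := by
  simp only [degree_eq_sum_ite, Fintype.sum_sum_type]
  simp

theorem degree_graphJoin_inr [Fintype V] [Fintype W] (w : W) :
    (graphJoin G H).degree (Sum.inr w) = Fintype.card V + H.degree w := by
  simp only [degree_eq_sum_ite, Fintype.sum_sum_type]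
  simp

theorem degree_cliqueUnion (v : Fin b × Fin r) : (cliqueUnion b r).degree v = r - 1 := by
  simp only [degree_eq_sum_ite, Fintype.sum_prod_type, cliqueUnion_adj, ite_and]
  simp [Finset.sum_ite, Finset.filter_ne]

theorem degree_cliqueWithCopies_inl [Fintype W] (s : Fin q) :
    (cliqueWithCopies q H).degree (Sum.inl s) = q - 1 + Fintype.card W := by
  simp only [degree_eq_sum_ite, Fintype.sum_sum_type, Fintype.sum_prod_type,
    cliqueWithCopies_adj_inl_inl, cliqueWithCopies_adj_inl_inr]
  simp [Finset.sum_ite, Finset.filter_ne, apply_ite Finset.card]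

theorem degree_cliqueWithCopies_inr [Fintype W] (u : Fin q × W) :
    (cliqueWithCopies q H).degree (Sum.inr u) = 1 + H.degree u.2 := by
  simp only [degree_eq_sum_ite, Fintype.sum_sum_type, Fintype.sum_prod_type,
    cliqueWithCopies_adj_inr_inl, cliqueWithCopies_adj_inr_inr, ite_and]
  simp

end Constructions

/-! ### Maximum `j`-independent sets in the constructions -/

theorem IsJIndependent.card_lt_of_adj {V : Type} [Fintype V] {G : SimpleGraph V} {j : ℕ}
    {I K : Finset V} (h : IsJIndependent G j I) (hj : 1 ≤ j) {v : V} (hv : v ∈ I) (hK : K ⊆ I)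
    (hadj : ∀ w ∈ K, G.Adj v w) : K.card < j :=
  (Finset.card_le_card fun w hw => Finset.mem_filter.2 ⟨hK hw, hadj w hw⟩).trans_lt
    ((isJIndependent_iff hj).1 h v hv)

theorem IsJIndependent.mono {V : Type} [Fintype V] {G : SimpleGraph V} {j : ℕ}
    {I K : Finset V} (h : IsJIndependent G j I) (hj : 1 ≤ j) (hK : K ⊆ I) :
    IsJIndependent G j K := by
  rw [isJIndependent_iff hj] at h ⊢
  exact fun v hv => (Finset.card_le_card (Finset.filter_subset_filter _ hK)).trans_lt (h v (hK hv))

theorem isJIndependent_map_iff {V W : Type} [Fintype V] [Fintype W] {G : SimpleGraph V}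
    {H : SimpleGraph W} (f : G ↪g H) {j : ℕ} (hj : 1 ≤ j) {I : Finset V} :
    IsJIndependent H j (I.map f.toEmbedding) ↔ IsJIndependent G j I := by
  simp [isJIndependent_iff hj, Finset.filter_map]

/-- The embedding of the first graph into a join. -/
def graphJoinInl {V W : Type} (G : SimpleGraph V) (H : SimpleGraph W) : G ↪g graphJoin G H :=
  ⟨Function.Embedding.inl, Iff.rfl⟩

/-- The embedding of the second graph into a join. -/
def graphJoinInr {V W : Type} (G : SimpleGraph V) (H : SimpleGraph W) : H ↪g graphJoin G H :=
  ⟨Function.Embedding.inr, Iff.rfl⟩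

/-- The embedding of `H` as the `i`-th copy in `cliqueWithCopies q H`. -/
def copyEmbedding {W : Type} {q : ℕ} (H : SimpleGraph W) (i : Fin q) :
    H ↪g cliqueWithCopies q H :=
  ⟨⟨fun w => Sum.inr (i, w), fun _ _ h => (Prod.ext_iff.1 (Sum.inr.inj h)).2⟩,
    ⟨fun h => h.2, fun h => ⟨rfl, h⟩⟩⟩

theorem copyEmbedding_apply {W : Type} {q : ℕ} (H : SimpleGraph W) (i : Fin q) (w : W) :
    (copyEmbedding H i).toEmbedding w = Sum.inr (i, w) := rfl

theorem isJIndependent_univ_cliqueUnion (b : ℕ) {j : ℕ} (hj : 1 ≤ j) :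
    IsJIndependent (cliqueUnion b j) j Finset.univ := by
  rw [isJIndependent_iff hj]
  intro v _
  have := degree_cliqueUnion v
  rw [degree_eq_sum_ite, ← Finset.card_filter] at this
  omega

/-- Each clique contributes at most `j` vertices: a chosen vertex is adjacent to all other chosen
vertices of its clique. -/
theorem IsJIndependent.card_le_of_cliqueUnion {b r j : ℕ} (hj : 1 ≤ j)
    {I : Finset (Fin b × Fin r)} (h : IsJIndependent (cliqueUnion b r) j I) : I.card ≤ b * j := by
  have := Finset.card_le_mul_card_image_of_maps_to (s := I) (t := Finset.univ) (f := Prod.fst)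
    (fun _ _ => Finset.mem_univ _) j fun i _ => by
      rcases (I.filter fun x => x.1 = i).eq_empty_or_nonempty with h0 | ⟨v, hv⟩
      · simp [h0]
      · have hlt := h.card_lt_of_adj hj (Finset.mem_filter.1 hv).1
          (K := (I.filter fun x => x.1 = i).erase v)
          ((Finset.erase_subset _ _).trans (Finset.filter_subset _ _)) (by
            intro w hw
            simp only [Finset.mem_erase, Finset.mem_filter] at hw hv
            refine ⟨hv.2.trans hw.2.2.symm, fun h2 => hw.1 (Prod.ext ?_ h2.symm)⟩
            exact hw.2.2.trans hv.2.symm)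
        have := Finset.card_erase_add_one hv
        omega
  simpa [mul_comm] using this

theorem IsJIndependent.toLeft {V W : Type} [Fintype V] [Fintype W] {G : SimpleGraph V}
    {H : SimpleGraph W} {j : ℕ} (hj : 1 ≤ j) {I : Finset (V ⊕ W)}
    (h : IsJIndependent (graphJoin G H) j I) : IsJIndependent G j I.toLeft :=
  (isJIndependent_map_iff (graphJoinInl G H) hj).1 <| h.mono hj <| by
    intro x
    simp only [Finset.mem_map, Finset.mem_toLeft]
    rintro ⟨a, ha, rfl⟩
    exact ha

theorem IsJIndependent.card_lt_of_toLeft_nonempty {V W : Type} [Fintype V] [Fintype W]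
    {G : SimpleGraph V} {H : SimpleGraph W} {j : ℕ} (hj : 1 ≤ j) {I : Finset (V ⊕ W)}
    (h : IsJIndependent (graphJoin G H) j I) (hl : I.toLeft.Nonempty) : I.toRight.card < j := by
  obtain ⟨v, hv⟩ := hl
  rw [← Finset.card_map Function.Embedding.inr]
  refine h.card_lt_of_adj hj (Finset.mem_toLeft.1 hv) ?_ ?_
  · intro x
    simp only [Finset.mem_map, Finset.mem_toRight]
    rintro ⟨a, ha, rfl⟩
    exact ha
  · intro x
    simp only [Finset.mem_map]
    rintro ⟨a, -, rfl⟩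
    trivial

theorem IsJIndependent.card_lt_of_toRight_nonempty {V W : Type} [Fintype V] [Fintype W]
    {G : SimpleGraph V} {H : SimpleGraph W} {j : ℕ} (hj : 1 ≤ j) {I : Finset (V ⊕ W)}
    (h : IsJIndependent (graphJoin G H) j I) (hr : I.toRight.Nonempty) : I.toLeft.card < j := by
  obtain ⟨v, hv⟩ := hr
  rw [← Finset.card_map Function.Embedding.inl]
  refine h.card_lt_of_adj hj (Finset.mem_toRight.1 hv) ?_ ?_
  · intro x
    simp only [Finset.mem_map, Finset.mem_toLeft]
    rintro ⟨a, ha, rfl⟩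
    exact ha
  · intro x
    simp only [Finset.mem_map]
    rintro ⟨a, -, rfl⟩
    trivial

/-- A competitor inside the left side has at most `p * j` vertices. One meeting both sides has fewer
than `j` on each, so fewer than `2 * j ≤ (p + 1) * j`. Any other lies in the right side. -/
theorem isUniqueMaxJIndep_cliqueUnionJoin {p j : ℕ} (r : ℕ) (hj : 1 ≤ j) (hp : 1 ≤ p) :
    IsUniqueMaxJIndep (cliqueUnionJoin p r j) j
      (Finset.univ.map Function.Embedding.inr) := by
  refine ⟨(isJIndependent_map_iff (graphJoinInr _ _) hj).2
    (isJIndependent_univ_cliqueUnion _ hj), fun I hI hne => ?_⟩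
  have hcard := I.card_toLeft_add_card_toRight
  rcases I.toLeft.eq_empty_or_nonempty with hl | hl
  · refine Finset.card_lt_card (lt_of_le_of_ne ?_ hne)
    rintro (a | b) h
    · have := Finset.mem_toLeft.2 h
      simp [hl] at this
    · simp
  · rw [Finset.card_map, Finset.card_univ, Fintype.card_prod, Fintype.card_fin, Fintype.card_fin]
    have h1 := (hI.toLeft hj).card_le_of_cliqueUnion hj
    rcases I.toRight.eq_empty_or_nonempty with hr | hr
    · rw [hr, Finset.card_empty] at hcard
      nlinarith
    · have h2 := hI.card_lt_of_toLeft_nonempty hj hl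
      have h3 := hI.card_lt_of_toRight_nonempty hj hr
      have h4 := Nat.mul_le_mul_right j hp
      rw [add_mul]
      omega

theorem isUniqueMaxJIndep_completeSplitGraph {s j : ℕ} (p : ℕ) (hj : 1 ≤ j) (hs : j < s) :
    IsUniqueMaxJIndep (completeSplitGraph s p) j
      (Finset.univ.map Function.Embedding.inl) := by
  refine ⟨(isJIndependent_map_iff (graphJoinInl _ _) hj).2 ?_, fun I hI hne => ?_⟩
  · rw [isJIndependent_iff hj]
    intro v _
    simp
    omega
  · rcases I.toRight.eq_empty_or_nonempty with hr | ⟨v, hv⟩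
    · refine Finset.card_lt_card (lt_of_le_of_ne ?_ hne)
      rintro (a | b) h
      · simp
      · have := Finset.mem_toRight.2 h
        simp [hr] at this
    · have hv' := Finset.mem_toRight.1 hv
      have h1 := hI.card_lt_of_adj hj hv' (Finset.erase_subset (Sum.inr v) I) (by
        rintro (a | b) h
        · trivial
        · exact fun h2 => (Finset.mem_erase.1 h).1 (congrArg Sum.inr h2.symm))
      have h2 := Finset.card_erase_add_one hv'
      rw [Finset.card_map, Finset.card_univ, Fintype.card_fin]
      omega

/-- The vertex set splits into `q` fibres, each a clique vertex with its copy of `H`. A fibre using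
its clique vertex holds at most `j < S.card` chosen vertices; any other is a `j`-independent set in
`H`, so it reaches `S.card` only by being `S`. -/
theorem IsUniqueMaxJIndep.cliqueWithCopies {W : Type} [Fintype W] {H : SimpleGraph W} {j : ℕ}
    {S : Finset W} (h : IsUniqueMaxJIndep H j S) (q : ℕ) (hj : 1 ≤ j) (hS : j < S.card) :
    IsUniqueMaxJIndep (cliqueWithCopies q H) j
      ((Finset.univ ×ˢ S).map Function.Embedding.inr) := by
  constructor
  · rw [isJIndependent_iff hj]
    intro v hv
    simp only [Finset.mem_map, Finset.mem_product] at hv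
    obtain ⟨⟨i, w⟩, ⟨-, hw⟩, rfl⟩ := hv
    refine lt_of_eq_of_lt ?_ ((isJIndependent_iff hj).1 h.1 w hw)
    rw [← Finset.card_map (copyEmbedding H i).toEmbedding]
    congr 1
    ext x
    rcases x with s | ⟨k, u⟩
    · simp [copyEmbedding_apply]
    · simp only [Finset.mem_filter, Finset.mem_map, Finset.mem_product, Finset.mem_univ, true_and,
        Function.Embedding.inr_apply, Sum.inr.injEq, exists_eq_right, copyEmbedding_apply,
        cliqueWithCopies_adj_inr_inr, Prod.mk.injEq]
      constructor
      · rintro ⟨hu, hik, huw⟩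
        exact ⟨u, ⟨hu, huw⟩, hik, rfl⟩
      · rintro ⟨a, ⟨hu, huw⟩, hik, rfl⟩
        exact ⟨hu, hik, huw⟩
  · intro I hI hne
    set π : Fin q ⊕ (Fin q × W) → Fin q := Sum.elim id Prod.fst
    set C : Fin q → Finset W := fun i => Finset.univ.filter fun w => Sum.inr (i, w) ∈ I
    have hfib : ∀ i, (I.filter fun x => π x = i).card < S.card ∨
        (Sum.inl i ∉ I ∧ C i = S ∧ (I.filter fun x => π x = i).card = S.card) := by
      intro i
      by_cases hi : Sum.inl i ∈ I
      · left
        have hmem : Sum.inl i ∈ I.filter fun x => π x = i := Finset.mem_filter.2 ⟨hi, rfl⟩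
        have h1 := hI.card_lt_of_adj hj hi
          (K := (I.filter fun x => π x = i).erase (Sum.inl i))
          ((Finset.erase_subset _ _).trans (Finset.filter_subset _ _)) (by
            rintro (s | x) hx
            · simp only [Finset.mem_erase, Finset.mem_filter] at hx
              exact absurd (congrArg Sum.inl hx.2.2) hx.1
            · simp only [Finset.mem_erase, Finset.mem_filter] at hx
              exact hx.2.2.symm)
        have h2 := Finset.card_erase_add_one hmem
        omega
      · have hC : (I.filter fun x => π x = i) = (C i).map (copyEmbedding H i).toEmbedding := by
          ext x
          rcases x with s | ⟨k, u⟩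
          · simp only [Finset.mem_filter, Finset.mem_map]
            constructor
            · rintro ⟨h1, h2⟩
              exact absurd ((show s = i from h2) ▸ h1) hi
            · rintro ⟨a, -, ha⟩
              cases ha
          · simp only [Finset.mem_filter, Finset.mem_map]
            constructor
            · rintro ⟨h1, h2⟩
              obtain rfl : k = i := h2
              exact ⟨u, by simpa [C] using h1, rfl⟩
            · rintro ⟨a, h1, ha⟩
              obtain ⟨rfl, rfl⟩ : i = k ∧ a = u := by simpa [copyEmbedding_apply] using ha
              exact ⟨by simpa [C] using h1, rfl⟩
        have hind : IsJIndependent H j (C i) :=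
          (isJIndependent_map_iff (copyEmbedding H i) hj).1
            (hI.mono hj (hC ▸ Finset.filter_subset _ _))
        rw [hC, Finset.card_map]
        by_cases hCS : C i = S
        · exact Or.inr ⟨hi, hCS, by rw [hCS]⟩
        · exact Or.inl (h.2 _ hind hCS)
    -- If no fibre were deficient, every fibre would be exactly its copy of `S`, making `I` the
    -- claimed optimum.
    have hex : ∃ i, (I.filter fun x => π x = i).card < S.card := by
      by_contra! hall
      have hall' := fun i => (hfib i).resolve_left (hall i).not_gt
      refine hne (Finset.ext ?_)
      rintro (s | ⟨k, u⟩)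
      · simp [(hall' s).1]
      · have : u ∈ C k ↔ u ∈ S := by rw [(hall' k).2.1]
        simpa [C] using this
    obtain ⟨i, hi⟩ := hex
    rw [Finset.card_eq_sum_card_fiberwise (f := π) (t := Finset.univ) (by simp), Finset.card_map,
      Finset.card_product, ← smul_eq_mul, ← Finset.sum_const]
    refine Finset.sum_lt_sum (fun k _ => ?_) ⟨i, Finset.mem_univ _, hi⟩
    rcases hfib k with h1 | h1
    · exact h1.le
    · exact h1.2.2.le

/-! ### Tools for the degree comparisons and the limits -/

theorem exists_card_eq_sum_degree_eq {V : Type} [Fintype V] {G : SimpleGraph V} {A : Finset V}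
    {d k : ℕ} (hd : ∀ v ∈ A, G.degree v = d) (hk : k ≤ A.card) :
    ∃ T ⊆ A, T.card = k ∧ ∑ v ∈ T, G.degree v = k * d := by
  obtain ⟨T, hT, rfl⟩ := Finset.exists_subset_card_eq hk
  exact ⟨T, hT, rfl, Finset.sum_const_nat fun v hv => hd v (hT hv)⟩

theorem sum_degree_map_univ {V α : Type} [Fintype V] [Fintype α] {G : SimpleGraph V} {d : ℕ}
    (f : α ↪ V) (hd : ∀ a, G.degree (f a) = d) :
    ∑ v ∈ Finset.univ.map f, G.degree v = Fintype.card α * d := by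
  rw [Finset.sum_map]
  exact Finset.sum_const_nat fun a _ => hd a

/-- With `p = j + t` this says `(p - j) * (p ^ 2 + (p + 1) * j) ≤ p ^ 3`, the comparison of small
and large degrees behind both limits of `a_j / α_j`. Writing `j = i + 1` makes the slack a
polynomial with nonnegative coefficients. -/
theorem mul_sq_add_le {j t : ℕ} (hj : 1 ≤ j) :
    t * ((j + t) ^ 2 + (j + t + 1) * j) ≤ (j + t) * (j + t) ^ 2 := by
  obtain ⟨i, rfl⟩ := Nat.exists_eq_add_of_le' hj
  calc t * ((i + 1 + t) ^ 2 + (i + 1 + t + 1) * (i + 1))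
    _ ≤ t * ((i + 1 + t) ^ 2 + (i + 1 + t + 1) * (i + 1)) +
        (i + 1) * ((i + 1 + t) * i + (i + 1)) :=
      Nat.le_add_right _ _
    _ = (i + 1 + t) * (i + 1 + t) ^ 2 := by ring

theorem tendsto_div_atTop_of_mul_le {u v w : ℕ → ℕ} (hw : Tendsto w atTop atTop)
    (h : ∀ᶠ p in atTop, w p * v p ≤ u p ∧ 0 < v p) :
    Tendsto (fun p => (u p : ℝ) / (v p : ℝ)) atTop atTop := by
  refine tendsto_atTop_mono' _ ?_ (tendsto_natCast_atTop_atTop.comp hw)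
  filter_upwards [h] with p hp
  rw [Function.comp_apply, le_div_iff₀ (by exact_mod_cast hp.2)]
  exact_mod_cast hp.1

/-! ### The union of cliques joined with a union of cliques -/

theorem degree_sharpGraph {j : ℕ} (v : (Fin j × Fin j) ⊕ (Fin j × Fin j)) :
    (sharpGraph j).degree v = j - 1 + j * j := by
  rcases v with v | v
  · rw [sharpGraph, degree_graphJoin_inl, degree_cliqueUnion]
    simp
  · rw [sharpGraph, degree_graphJoin_inr, degree_cliqueUnion]
    simp [add_comm]

theorem degree_cliqueUnionJoin_inl (p r j : ℕ) (v : Fin p × Fin r) :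
    (cliqueUnionJoin p r j).degree (Sum.inl v) = r - 1 + (p + 1) * j := by
  rw [cliqueUnionJoin, degree_graphJoin_inl, degree_cliqueUnion]
  simp

theorem degree_cliqueUnionJoin_inr (p r j : ℕ) (v : Fin (p + 1) × Fin j) :
    (cliqueUnionJoin p r j).degree (Sum.inr v) = p * r + (j - 1) := by
  rw [cliqueUnionJoin, degree_graphJoin_inr, degree_cliqueUnion]
  simp

theorem jIndepNum_cliqueUnionJoin {p j : ℕ} (r : ℕ) (hj : 1 ≤ j) (hp : 1 ≤ p) :
    jIndepNum (cliqueUnionJoin p r j) j = (p + 1) * j := by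
  rw [(isUniqueMaxJIndep_cliqueUnionJoin r hj hp).jIndepNum_eq]
  simp

theorem lowerAnnihilationNum_cliqueUnionJoin {p j : ℕ} (hj : 1 ≤ j) (h : p + j ≤ p ^ 2) :
    lowerAnnihilationNum (cliqueUnionJoin p (p ^ 2) j) j =
      jIndepNum (cliqueUnionJoin p (p ^ 2) j) j := by
  have hp : 1 ≤ p := by
    by_contra! h0
    obtain rfl : p = 0 := by omega
    simp at h
    omega
  refine le_antisymm (lowerAnnihilationNum_le_jIndepNum _ hj) ?_
  have h1 := (isUniqueMaxJIndep_cliqueUnionJoin (p ^ 2) hj hp).le_lowerAnnihilationNum_mul hj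
    (d := p * p ^ 2 + (j - 1)) (by
      rintro (v | v)
      · rw [degree_cliqueUnionJoin_inl]
        -- Multiplying `p + j ≤ p ^ 2` by `p` shows that left degrees do not exceed right degrees,
        -- so the optimal set consists of vertices of maximum degree.
        have := Nat.mul_le_mul_left p h
        have h2 : p * (p + j) + j = p ^ 2 + (p + 1) * j := by ring
        have : 1 ≤ p ^ 2 := Nat.one_le_pow _ _ hp
        omega
      · rw [degree_cliqueUnionJoin_inr])
  rw [sum_degree_map_univ Function.Embedding.inr (degree_cliqueUnionJoin_inr _ _ _)] at h1
  simp only [Fintype.card_prod, Fintype.card_fin] at h1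
  rw [jIndepNum_cliqueUnionJoin _ hj hp]
  exact Nat.le_of_mul_le_mul_right h1 (by positivity)

theorem sub_mul_jIndepNum_le_upperAnnihilationNum_cliqueUnionJoin {p j : ℕ} (hj : 1 ≤ j)
    (hp : j ≤ p) :
    (p - j) * jIndepNum (cliqueUnionJoin p (p ^ 2) j) j ≤
      upperAnnihilationNum (cliqueUnionJoin p (p ^ 2) j) j := by
  obtain ⟨t, rfl⟩ := Nat.exists_eq_add_of_le hp
  have hp1 : 1 ≤ j + t := by omega
  rw [jIndepNum_cliqueUnionJoin _ hj hp1, Nat.add_sub_cancel_left]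
  have hkey := mul_sq_add_le (t := t) hj
  set p := j + t with hpt
  obtain ⟨T, -, hT, hsum⟩ := exists_card_eq_sum_degree_eq (G := cliqueUnionJoin p (p ^ 2) j)
    (A := Finset.univ.map Function.Embedding.inl) (k := t * ((p + 1) * j))
    (d := p ^ 2 - 1 + (p + 1) * j) (by
      intro v hv
      obtain ⟨w, -, rfl⟩ := Finset.mem_map.1 hv
      exact degree_cliqueUnionJoin_inl _ _ _ _) (by
      simp only [Finset.card_map, Finset.card_univ, Fintype.card_prod, Fintype.card_fin]
      -- The same inequality guarantees enough left vertices: drop `p ^ 2` from its second factor.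
      exact (Nat.mul_le_mul_left _ (by omega)).trans hkey)
  rw [← hT]
  refine (isUniqueMaxJIndep_cliqueUnionJoin (p ^ 2) hj hp1).card_le_upperAnnihilationNum hj ?_
  rw [hsum, sum_degree_map_univ Function.Embedding.inr (degree_cliqueUnionJoin_inr _ _ _),
    Fintype.card_prod, Fintype.card_fin, Fintype.card_fin, mul_comm t, mul_assoc]
  -- The common factor `(p + 1) * j` cancels, and the left degree is rounded up to `p ^ 2 + (p + 1)
  -- * j`.
  refine Nat.mul_le_mul_left _ (le_trans (Nat.mul_le_mul_left _ ?_) (hkey.trans (by omega)))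
  omega

/-! ### Complete split graphs -/

theorem degree_completeSplitGraph_inl (s p : ℕ) (v : Fin s) :
    (completeSplitGraph s p).degree (Sum.inl v) = p := by
  rw [completeSplitGraph, degree_graphJoin_inl]
  simp

theorem degree_completeSplitGraph_inr (s p : ℕ) (v : Fin p) :
    (completeSplitGraph s p).degree (Sum.inr v) = s + (p - 1) := by
  rw [completeSplitGraph, degree_graphJoin_inr, degree_eq_sum_ite]
  simp [Finset.sum_ite, Finset.filter_ne]

theorem jIndepNum_completeSplitGraph {s j : ℕ} (p : ℕ) (hj : 1 ≤ j) (hs : j < s) :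
    jIndepNum (completeSplitGraph s p) j = s := by
  rw [(isUniqueMaxJIndep_completeSplitGraph p hj hs).jIndepNum_eq]
  simp

theorem upperAnnihilationNum_completeSplitGraph {s p j : ℕ} (hj : 1 ≤ j) (hs : j < s)
    (hp : 1 ≤ p) :
    upperAnnihilationNum (completeSplitGraph s p) j = jIndepNum (completeSplitGraph s p) j := by
  refine le_antisymm ?_ (jIndepNum_le_upperAnnihilationNum _ hj)
  have h1 := (isUniqueMaxJIndep_completeSplitGraph p hj hs).upperAnnihilationNum_mul_le hj
    (d := p) (by
      rintro (v | v)
      · rw [degree_completeSplitGraph_inl]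
      · rw [degree_completeSplitGraph_inr]
        omega)
  rw [sum_degree_map_univ Function.Embedding.inl (degree_completeSplitGraph_inl _ _)] at h1
  simp only [Fintype.card_fin] at h1
  rw [jIndepNum_completeSplitGraph p hj hs]
  exact Nat.le_of_mul_le_mul_right h1 hp

theorem lowerAnnihilationNum_completeSplitGraph_le {s p j : ℕ} (hj : 1 ≤ j) (hs : j < s) :
    lowerAnnihilationNum (completeSplitGraph s p) j ≤ p := by
  have h1 := (isUniqueMaxJIndep_completeSplitGraph p hj hs).lowerAnnihilationNum_le_card hj
    (T := Finset.univ.map Function.Embedding.inr) (by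
      rw [sum_degree_map_univ Function.Embedding.inl (degree_completeSplitGraph_inl _ _),
        sum_degree_map_univ Function.Embedding.inr (degree_completeSplitGraph_inr _ _),
        Fintype.card_fin, Fintype.card_fin]
      nlinarith [Nat.zero_le (p - 1)])
  simpa using h1

/-- Needed because a real quotient with denominator `0` is `0`. The optimal set has positive degree
sum, so a crude degree bound suffices. -/
theorem lowerAnnihilationNum_completeSplitGraph_pos {s p j : ℕ} (hj : 1 ≤ j) (hs : j < s)
    (hp : 1 ≤ p) : 0 < lowerAnnihilationNum (completeSplitGraph s p) j := by
  have h1 := (isUniqueMaxJIndep_completeSplitGraph p hj hs).le_lowerAnnihilationNum_mul hj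
    (d := s + p) (by
      rintro (v | v)
      · rw [degree_completeSplitGraph_inl]
        omega
      · rw [degree_completeSplitGraph_inr]
        omega)
  rw [sum_degree_map_univ Function.Embedding.inl (degree_completeSplitGraph_inl _ _)] at h1
  simp only [Fintype.card_fin] at h1
  have h2 : 0 < s * p := Nat.mul_pos (by omega) hp
  exact Nat.pos_of_mul_pos_right (h2.trans_le h1)

/-! ### The composite graphs -/

theorem degree_compositeGraph_inl (p q r j : ℕ) (s : Fin q) :
    (compositeGraph p q r j).degree (Sum.inl s) = q - 1 + (p * r + (p + 1) * j) := by
  rw [compositeGraph, degree_cliqueWithCopies_inl]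
  simp

theorem degree_compositeGraph_inr_inl (p q r j : ℕ) (s : Fin q) (v : Fin p × Fin r) :
    (compositeGraph p q r j).degree (Sum.inr (s, Sum.inl v)) = 1 + (r - 1 + (p + 1) * j) := by
  rw [compositeGraph, degree_cliqueWithCopies_inr, degree_cliqueUnionJoin_inl]

theorem degree_compositeGraph_inr_inr (p q r j : ℕ) (s : Fin q) (v : Fin (p + 1) × Fin j) :
    (compositeGraph p q r j).degree (Sum.inr (s, Sum.inr v)) = 1 + (p * r + (j - 1)) := by
  rw [compositeGraph, degree_cliqueWithCopies_inr, degree_cliqueUnionJoin_inr]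

/-- The vertices of the copies of `K_j` in `G(p, q, r, j)`. -/
def compositeCore (p q r j : ℕ) :
    Finset (Fin q ⊕ (Fin q × ((Fin p × Fin r) ⊕ (Fin (p + 1) × Fin j)))) :=
  (Finset.univ ×ˢ Finset.univ.map Function.Embedding.inr).map Function.Embedding.inr

theorem card_compositeCore (p q r j : ℕ) : (compositeCore p q r j).card = q * ((p + 1) * j) := by
  simp [compositeCore]

theorem degree_of_mem_compositeCore {p q r j : ℕ} (hj : 1 ≤ j)
    {v : Fin q ⊕ (Fin q × ((Fin p × Fin r) ⊕ (Fin (p + 1) × Fin j)))}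
    (hv : v ∈ compositeCore p q r j) : (compositeGraph p q r j).degree v = p * r + j := by
  simp only [compositeCore, Finset.mem_map, Finset.mem_product] at hv
  obtain ⟨⟨s, w⟩, ⟨-, ⟨u, -, rfl⟩⟩, rfl⟩ := hv
  refine (degree_compositeGraph_inr_inr p q r j s u).trans ?_
  omega

theorem sum_degree_compositeCore (p q r : ℕ) {j : ℕ} (hj : 1 ≤ j) :
    ∑ v ∈ compositeCore p q r j, (compositeGraph p q r j).degree v =
      q * ((p + 1) * j) * (p * r + j) := by
  rw [Finset.sum_const_nat fun v hv => degree_of_mem_compositeCore hj hv, card_compositeCore]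

theorem isUniqueMaxJIndep_compositeGraph {p j : ℕ} (q r : ℕ) (hj : 1 ≤ j) (hp : 1 ≤ p) :
    IsUniqueMaxJIndep (compositeGraph p q r j) j (compositeCore p q r j) :=
  (isUniqueMaxJIndep_cliqueUnionJoin r hj hp).cliqueWithCopies q hj <| by
    rw [Finset.card_map, Finset.card_univ, Fintype.card_prod, Fintype.card_fin, Fintype.card_fin]
    nlinarith

theorem jIndepNum_compositeGraph {p j : ℕ} (q r : ℕ) (hj : 1 ≤ j) (hp : 1 ≤ p) :
    jIndepNum (compositeGraph p q r j) j = q * ((p + 1) * j) := by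
  rw [(isUniqueMaxJIndep_compositeGraph q r hj hp).jIndepNum_eq, card_compositeCore]

/-- A clique vertex has degree `p ^ 2 - 1 + p * j` above a core vertex. Over `p ^ 2` clique vertices
this excess pays for `p - 1` further core vertices. -/
theorem lowerAnnihilationNum_compositeGraph_add_le {p j : ℕ} (hj : 1 ≤ j) (hp : 1 ≤ p) :
    lowerAnnihilationNum (compositeGraph p (p ^ 2) (p ^ 2) j) j + (p - 1) ≤
      jIndepNum (compositeGraph p (p ^ 2) (p ^ 2) j) j := by
  obtain ⟨s, rfl⟩ := Nat.exists_eq_add_of_le' hp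
  rw [jIndepNum_compositeGraph _ _ hj hp, Nat.add_sub_cancel]
  set p := s + 1 with hps
  have hge : p ^ 2 + s ≤ p ^ 2 * ((p + 1) * j) := by
    have h1 : p ^ 2 * ((p + 1) * 1) ≤ p ^ 2 * ((p + 1) * j) := by gcongr
    nlinarith [Nat.one_le_pow 2 p hp]
  -- `k` is the number of core vertices kept after `p ^ 2 + s` of them, with `s = p - 1`, are traded
  -- away.
  obtain ⟨k, hk⟩ := Nat.exists_eq_add_of_le hge
  obtain ⟨T, hTA, hT, hsum⟩ := exists_card_eq_sum_degree_eq (k := k)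
    (fun v => degree_of_mem_compositeCore (p := p) (q := p ^ 2) (r := p ^ 2) (v := v) hj) (by
      rw [card_compositeCore]
      omega)
  have hdisj : Disjoint (Finset.univ.map Function.Embedding.inl) T := by
    rw [Finset.disjoint_left]
    intro v hv hvT
    have := hTA hvT
    obtain ⟨a, -, rfl⟩ := Finset.mem_map.1 hv
    simp [compositeCore] at this
  have h1 := (isUniqueMaxJIndep_compositeGraph (p ^ 2) (p ^ 2) hj hp).lowerAnnihilationNum_le_card
    hj (T := (Finset.univ.map Function.Embedding.inl).disjUnion T hdisj) (by
      rw [Finset.sum_disjUnion, hsum, sum_degree_compositeCore _ _ _ hj,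
        sum_degree_map_univ Function.Embedding.inl (degree_compositeGraph_inl _ _ _ _),
        Fintype.card_fin, hk, add_mul, Nat.add_le_add_iff_right]
      have hsq : p ^ 2 - 1 = s ^ 2 + 2 * s := by
        rw [hps, show (s + 1) ^ 2 = s ^ 2 + 2 * s + 1 by ring, Nat.add_sub_cancel]
      rw [hsq, hps]
      -- The added summand is the exact surplus of the clique's degree sum over that of the removed
      -- core vertices.
      calc ((s + 1) ^ 2 + s) * ((s + 1) * (s + 1) ^ 2 + j)
        _ ≤ ((s + 1) ^ 2 + s) * ((s + 1) * (s + 1) ^ 2 + j) +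
            ((s + 1) ^ 2 * s + j * (s ^ 3 + 3 * s ^ 2 + 2 * s + 1)) := Nat.le_add_right _ _
        _ = (s + 1) ^ 2 * (s ^ 2 + 2 * s + ((s + 1) * (s + 1) ^ 2 + (s + 1 + 1) * j)) := by
          ring)
  rw [Finset.card_disjUnion, hT, Finset.card_map, Finset.card_univ, Fintype.card_fin] at h1
  omega

theorem sub_mul_jIndepNum_le_upperAnnihilationNum_compositeGraph {p j : ℕ} (hj : 1 ≤ j)
    (hp : j ≤ p) :
    (p - j) * jIndepNum (compositeGraph p (p ^ 2) (p ^ 2) j) j ≤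
      upperAnnihilationNum (compositeGraph p (p ^ 2) (p ^ 2) j) j := by
  obtain ⟨t, rfl⟩ := Nat.exists_eq_add_of_le hp
  have hp1 : 1 ≤ j + t := by omega
  rw [jIndepNum_compositeGraph _ _ hj hp1, Nat.add_sub_cancel_left]
  have hkey := mul_sq_add_le (t := t) hj
  set p := j + t with hpt
  obtain ⟨T, -, hT, hsum⟩ := exists_card_eq_sum_degree_eq
    (G := compositeGraph p (p ^ 2) (p ^ 2) j)
    (A := (Finset.univ ×ˢ Finset.univ.map Function.Embedding.inl).map Function.Embedding.inr)
    (k := t * (p ^ 2 * ((p + 1) * j))) (d := 1 + (p ^ 2 - 1 + (p + 1) * j)) (by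
      intro v hv
      simp only [Finset.mem_map, Finset.mem_product] at hv
      obtain ⟨⟨s, w⟩, ⟨-, ⟨u, -, rfl⟩⟩, rfl⟩ := hv
      exact degree_compositeGraph_inr_inl _ _ _ _ _ _) (by
      simp only [Finset.card_map, Finset.card_product, Finset.card_univ, Fintype.card_prod,
        Fintype.card_fin]
      -- Pulling out the `p ^ 2` copies reduces the count to that of a single copy.
      rw [mul_left_comm]
      exact Nat.mul_le_mul_left _ ((Nat.mul_le_mul_left _ (by omega)).trans hkey))
  rw [← hT]
  refine (isUniqueMaxJIndep_compositeGraph _ _ hj hp1).card_le_upperAnnihilationNum hj ?_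
  rw [hsum, sum_degree_compositeCore _ _ _ hj, mul_comm t, mul_assoc]
  have : 1 ≤ p ^ 2 := Nat.one_le_pow _ _ hp1
  refine Nat.mul_le_mul_left _ (le_trans (Nat.mul_le_mul_left _ ?_) (hkey.trans (by omega)))
  omega

/-! ### Assembling the four families -/

theorem mainTheorem10 (j : ℕ) (hj : 1 ≤ j) :
    (lowerAnnihilationNum (sharpGraph j) j = jIndepNum (sharpGraph j) j ∧
      jIndepNum (sharpGraph j) j = upperAnnihilationNum (sharpGraph j) j) ∧
    ((∀ p : ℕ, p + j ≤ p ^ 2 →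
        lowerAnnihilationNum (cliqueUnionJoin p (p ^ 2) j) j =
          jIndepNum (cliqueUnionJoin p (p ^ 2) j) j) ∧
      Tendsto (fun p : ℕ =>
        (upperAnnihilationNum (cliqueUnionJoin p (p ^ 2) j) j : ℝ) /
          (jIndepNum (cliqueUnionJoin p (p ^ 2) j) j : ℝ)) atTop atTop) ∧
    ((∀ p : ℕ, j < p ^ 2 →
        upperAnnihilationNum (completeSplitGraph (p ^ 2) p) j =
          jIndepNum (completeSplitGraph (p ^ 2) p) j) ∧
      Tendsto (fun p : ℕ =>
        (jIndepNum (completeSplitGraph (p ^ 2) p) j : ℝ) /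
          (lowerAnnihilationNum (completeSplitGraph (p ^ 2) p) j : ℝ)) atTop atTop) ∧
    (Tendsto (fun p : ℕ =>
        (jIndepNum (compositeGraph p (p ^ 2) (p ^ 2) j) j : ℝ) -
          (lowerAnnihilationNum (compositeGraph p (p ^ 2) (p ^ 2) j) j : ℝ)) atTop atTop ∧
      Tendsto (fun p : ℕ =>
        (upperAnnihilationNum (compositeGraph p (p ^ 2) (p ^ 2) j) j : ℝ) /
          (jIndepNum (compositeGraph p (p ^ 2) (p ^ 2) j) j : ℝ)) atTop atTop) := by
  refine ⟨⟨lowerAnnihilationNum_eq_of_regular hj (by positivity) degree_sharpGraph,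
    (upperAnnihilationNum_eq_of_regular hj (by positivity) degree_sharpGraph).symm⟩,
    ⟨fun p hp => lowerAnnihilationNum_cliqueUnionJoin hj hp, ?_⟩, ⟨fun p hp => ?_, ?_⟩, ?_, ?_⟩
  · refine tendsto_div_atTop_of_mul_le (tendsto_sub_atTop_nat j) ?_
    filter_upwards [eventually_ge_atTop j] with p hp
    refine ⟨sub_mul_jIndepNum_le_upperAnnihilationNum_cliqueUnionJoin hj hp, ?_⟩
    rw [jIndepNum_cliqueUnionJoin _ hj (hj.trans hp)]
    positivity
  · refine upperAnnihilationNum_completeSplitGraph hj hp (Nat.one_le_iff_ne_zero.2 ?_)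
    rintro rfl
    simp at hp
  · refine tendsto_div_atTop_of_mul_le tendsto_id ?_
    filter_upwards [eventually_gt_atTop j] with p hp
    have hp2 : j < p ^ 2 := by nlinarith
    refine ⟨?_, lowerAnnihilationNum_completeSplitGraph_pos hj hp2 (by omega)⟩
    rw [jIndepNum_completeSplitGraph _ hj hp2, pow_two, id]
    exact Nat.mul_le_mul_left _ (pow_two p ▸ lowerAnnihilationNum_completeSplitGraph_le hj hp2)
  · refine tendsto_atTop_mono' _ ?_ (tendsto_natCast_atTop_atTop.comp (tendsto_sub_atTop_nat 1))
    filter_upwards [eventually_ge_atTop 1] with p hp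
    rw [Function.comp_apply, le_sub_iff_add_le']
    exact_mod_cast lowerAnnihilationNum_compositeGraph_add_le hj hp
  · refine tendsto_div_atTop_of_mul_le (tendsto_sub_atTop_nat j) ?_
    filter_upwards [eventually_ge_atTop j] with p hp
    refine ⟨sub_mul_jIndepNum_le_upperAnnihilationNum_compositeGraph hj hp, ?_⟩
    have hp1 := hj.trans hp
    rw [jIndepNum_compositeGraph _ _ hj hp1]
    positivity
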